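/- The path variant of the Explorer-Director game is played on a finite graph $G$ with a token that starts on a vertex $v$. In each round, with the token on $u$, the Explorer calls an integer $l\ge 1$ such that some path of length $l$ in $G$ starts at $u$, and the Director then moves the token to any vertex $w$ for which $G$ contains a $u$–$w$ path (without repeated vertices) of length $l$. The Explorer wants to maximize, and the Director to minimize, the number of vertices visited by the token (the starting vertex counts as visited). Let $f_p(G,v)$ be the final number of visited vertices under optimal play, i.e. the largest $k$ such that the Explorer can force at least $k$ vertices to be visited after finitely many rounds. Let $Q_n$ be the $n$-dimensional hypercube, whose vertices are the binary strings of length $n$, two of them being adjacent exactly when they differ in exactly one bit. Then for every $n\ge 0$ and every vertex $v$ of $Q_n$, $$f_p(Q_n,v)=\begin{cases}1 & \text{if } n=0,\\ 2 & \text{if } n=1,\\ 4 & \text{if } n\ge 2.\end{cases}$$ -/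

import Mathlib

/-- The `n`-dimensional hypercube: its vertices are the binary strings of length `n`, and two
of them are adjacent exactly when they differ in exactly one bit. -/
def hypercubeGraph (n : ℕ) : SimpleGraph (Fin n → Bool) where
  Adj x y := hammingDist x y = 1
  symm := ⟨fun x y h => by rw [hammingDist_comm]; exact h⟩
  loopless := ⟨fun x h => by simp at h⟩

namespace SimpleGraph

/-- There is a path of `G` (no repeated vertices) from `u` to `v` with exactly `l` edges. -/
def HasPathOfLength {V : Type*} (G : SimpleGraph V) (u v : V) (l : ℕ) : Prop :=
  ∃ p : G.Walk u v, p.IsPath ∧ p.length = l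

/-- `G.ExplorerForces k u S`: in the path variant of the Explorer-Director game on `G`, with the
token on `u` and with `S` the set of vertices visited so far, the Explorer can guarantee, whatever
the Director does, that after finitely many further rounds at least `k` vertices have been visited.
In a round with the token on `u`, the Explorer calls a length `l ≥ 1` for which some path of
length `l` starts at `u`, and the Director moves the token to any vertex `v` for which
there is a `u`-`v` path of length `l`. -/
inductive ExplorerForces {V : Type*} [DecidableEq V] (G : SimpleGraph V) (k : ℕ) :
    V → Finset V → Prop
  | done (u : V) (S : Finset V) (h : k ≤ S.card) : ExplorerForces G k u S
  | call (u : V) (S : Finset V) (l : ℕ) (hpos : 1 ≤ l)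
      (hvalid : ∃ v, G.HasPathOfLength u v l)
      (h : ∀ v, G.HasPathOfLength u v l → ExplorerForces G k v (insert v S)) :
      ExplorerForces G k u S

/-- The Explorer can never force more visits than there are vertices. -/
theorem ExplorerForces.le_card {V : Type*} [Fintype V] [DecidableEq V] {G : SimpleGraph V}
    {k : ℕ} {u : V} {S : Finset V} (h : G.ExplorerForces k u S) : k ≤ Fintype.card V := by
  induction h with
  | done u S h => exact h.trans (Finset.card_le_univ S)
  | call u S l hpos hvalid h ih =>
    obtain ⟨v, hv⟩ := hvalid
    exact ih v hv

/-- `f_p(G, v)`: the number of vertices visited under optimal play in the path variant of the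
Explorer-Director game on the finite graph `G` with the token starting on `v` (which counts as
visited), that is, the largest number of visited vertices that the Explorer can force. -/
noncomputable def pathExplorerDirectorNumber {V : Type*} [Fintype V] [DecidableEq V]
    (G : SimpleGraph V) (v : V) : ℕ :=
  sSup {k : ℕ | G.ExplorerForces k v {v}}

/-- The supremum defining `f_p(G, v)` is attained. -/
theorem isGreatest_pathExplorerDirectorNumber {V : Type*} [Fintype V] [DecidableEq V]
    (G : SimpleGraph V) (v : V) :
    IsGreatest {k : ℕ | G.ExplorerForces k v {v}} (G.pathExplorerDirectorNumber v) := by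
  have hb : BddAbove {k : ℕ | G.ExplorerForces k v {v}} :=
    ⟨Fintype.card V, fun k hk => ExplorerForces.le_card hk⟩
  exact ⟨Nat.sSup_mem ⟨0, ExplorerForces.done _ _ (Nat.zero_le _)⟩ hb, fun k hk => le_csSup hb hk⟩

end SimpleGraph

namespace SimpleGraph

/-! For `n ≥ 2` the Director confines the token to a 2-dimensional face in directions `i`, `j`: flip
`i` on odd calls, `i` and `j` on even ones. This is always legal, since paths to these vertices
exist in every length of the right parity below `2 ^ n` (`hasSubcubePath_flipBit`,
`hasSubcubePath_flipBit_flipBit`). Conversely, bipartiteness lets calls of 1 and 2 force two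
vertices of each colour (`explorerForces_four`). For `n ≤ 1` the vertex count is the upper bound. -/

theorem ExplorerForces.le_card_of_trap {V : Type*} [DecidableEq V] {G : SimpleGraph V}
    {F : Finset V}
    (hF : ∀ u ∈ F, ∀ l, 1 ≤ l → (∃ w, G.HasPathOfLength u w l) →
      ∃ w ∈ F, G.HasPathOfLength u w l)
    {k : ℕ} {u : V} {S : Finset V} (h : G.ExplorerForces k u S) (hu : u ∈ F) (hS : S ⊆ F) :
    k ≤ F.card := by
  induction h with
  | done u S h => exact h.trans (Finset.card_le_card hS)
  | call u S l hpos hvalid h ih =>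
    obtain ⟨w, hw, hp⟩ := hF u hu l hpos hvalid
    exact ih w hp hw (Finset.insert_subset hw hS)

theorem Adj.hasPathOfLength_one {V : Type*} {G : SimpleGraph V} {u v : V} (h : G.Adj u v) :
    G.HasPathOfLength u v 1 :=
  ⟨h.toWalk, by simp [h.ne], by simp⟩

theorem HasPathOfLength.adj {V : Type*} {G : SimpleGraph V} {u v : V}
    (h : G.HasPathOfLength u v 1) : G.Adj u v := by
  obtain ⟨p, -, hl⟩ := h
  exact Walk.adj_of_length_eq_one hl

theorem HasPathOfLength.ne {V : Type*} {G : SimpleGraph V} {u v : V} {l : ℕ}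
    (h : G.HasPathOfLength u v l) (hl : l ≠ 0) : u ≠ v := by
  rintro rfl
  obtain ⟨p, hp, rfl⟩ := h
  exact hl (Walk.length_eq_zero_iff.2 (Walk.isPath_iff_nil.1 hp))

theorem HasPathOfLength.exists_adj_adj {V : Type*} {G : SimpleGraph V} {u v : V}
    (h : G.HasPathOfLength u v 2) : ∃ w, G.Adj u w ∧ G.Adj w v := by
  obtain ⟨p, -, hl⟩ := h
  cases p with
  | nil => simp at hl
  | cons h q => exact ⟨_, h, Walk.adj_of_length_eq_one (by simpa using hl)⟩

/-- On a two-colourable graph where paths of length `1` and `2` start everywhere, the calls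
`1, 2, 1, 2` force four visited vertices. -/
theorem explorerForces_four {V : Type*} [DecidableEq V] {G : SimpleGraph V}
    (C : G.Coloring Bool) (h1 : ∀ u, ∃ v, G.HasPathOfLength u v 1)
    (h2 : ∀ u, ∃ v, G.HasPathOfLength u v 2) (v : V) : G.ExplorerForces 4 v {v} := by
  have c1 : ∀ {x y}, G.HasPathOfLength x y 1 → C x ≠ C y := fun h => C.valid h.adj
  have c2 : ∀ {x y}, G.HasPathOfLength x y 2 → C x = C y := fun h => by
    obtain ⟨w, h, h'⟩ := h.exists_adj_adj
    exact (by decide : ∀ a b c : Bool, a ≠ b → b ≠ c → a = c) _ _ _ (C.valid h) (C.valid h')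
  have hC : ∀ {x y}, C x ≠ C y → x ≠ y := fun h e => h (congrArg C e)
  refine .call _ _ 1 le_rfl (h1 v) fun a ha => ?_
  refine .call _ _ 2 one_le_two (h2 a) fun b hb => ?_
  refine .call _ _ 1 le_rfl (h1 b) fun c hc => ?_
  have hab := hb.ne two_ne_zero
  have cva := c1 ha
  have cab := c2 hb
  have cbc := c1 hc
  -- `c` has the colour of `v`, opposite to `a` and `b`. If the Director returned to `v`, one more
  -- call of 2 leaves `v` within its colour class.
  by_cases hcv : c = v
  · subst hcv
    refine .call _ _ 2 one_le_two (h2 c) fun d hd => .done _ _ ?_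
    have hcd := hd.ne two_ne_zero
    have ccd := c2 hd
    have hda : d ≠ a := hC (ccd ▸ cva)
    have hdb : d ≠ b := hC (ccd ▸ cbc.symm)
    simp [hda, hdb, hcd.symm, hab.symm, hC cva.symm, hC cbc]
  · refine .done _ _ ?_
    have hca : c ≠ a := hC (cab ▸ cbc.symm)
    have hbv : b ≠ v := hC (cab ▸ cva.symm)
    simp [hca, hbv, hcv, hab.symm, hC cva.symm, hC cbc.symm]

end SimpleGraph

open SimpleGraph

/-- The binary string `u` with the bit `i` flipped. -/
def flipBit {n : ℕ} (i : Fin n) (u : Fin n → Bool) : Fin n → Bool :=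
  Function.update u i (!u i)

section flipBit

variable {n : ℕ}

theorem flipBit_apply (i j : Fin n) (u : Fin n → Bool) :
    flipBit i u j = if j = i then !u j else u j := by
  unfold flipBit
  by_cases h : j = i
  · subst h; simp
  · simp [h]

theorem flipBit_flipBit (i : Fin n) (u : Fin n → Bool) : flipBit i (flipBit i u) = u := by
  ext j; simp only [flipBit_apply]; split <;> simp

theorem flipBit_comm (i j : Fin n) (u : Fin n → Bool) :
    flipBit i (flipBit j u) = flipBit j (flipBit i u) := by
  ext k; simp only [flipBit_apply]; split <;> split <;> rfl

theorem hypercubeGraph_adj_iff (u v : Fin n → Bool) :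
    (hypercubeGraph n).Adj u v ↔ ∃ i, v = flipBit i u := by
  change hammingDist u v = 1 ↔ _
  rw [hammingDist, Finset.card_eq_one]
  refine exists_congr fun i => ?_
  simp only [Finset.ext_iff, funext_iff, flipBit_apply, Finset.mem_filter, Finset.mem_univ,
    true_and, Finset.mem_singleton]
  refine forall_congr' fun j => ?_
  by_cases h : j = i <;> cases u j <;> cases v j <;> simp [h]

theorem hypercubeGraph_adj_flipBit (i : Fin n) (u : Fin n → Bool) :
    (hypercubeGraph n).Adj u (flipBit i u) :=
  (hypercubeGraph_adj_iff _ _).2 ⟨i, rfl⟩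

/-- The parity colouring of the hypercube. -/
def hypercubeParity (n : ℕ) : (hypercubeGraph n).Coloring Bool :=
  Coloring.mk (fun u => decide (Even (∑ i, (u i).toNat))) fun {u v} h => by
    obtain ⟨i, rfl⟩ := (hypercubeGraph_adj_iff _ _).1 h
    rw [← Finset.add_sum_erase _ _ (Finset.mem_univ i),
      ← Finset.add_sum_erase _ (fun j => (flipBit i u j).toNat) (Finset.mem_univ i)]
    have : ∑ j ∈ Finset.univ.erase i, (flipBit i u j).toNat =
        ∑ j ∈ Finset.univ.erase i, (u j).toNat :=
      Finset.sum_congr rfl fun j hj => by rw [flipBit_apply, if_neg (Finset.ne_of_mem_erase hj)]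
    rw [this, flipBit_apply, if_pos rfl]
    rw [Ne, decide_eq_decide]
    cases u i <;> simp [Nat.even_add, -Nat.not_even_iff_odd]

/-- Some path of length `l` from `u` to `w` only changes bits in `s`. -/
def HasSubcubePath (s : Finset (Fin n)) (u w : Fin n → Bool) (l : ℕ) : Prop :=
  ∃ p : (hypercubeGraph n).Walk u w,
    p.IsPath ∧ p.length = l ∧ ∀ x ∈ p.support, ∀ j ∉ s, x j = u j

theorem HasSubcubePath.refl (s : Finset (Fin n)) (u : Fin n → Bool) : HasSubcubePath s u u 0 :=
  ⟨.nil, by simp, rfl, by simp⟩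

theorem HasSubcubePath.hasPathOfLength {s : Finset (Fin n)} {u w : Fin n → Bool} {l : ℕ}
    (h : HasSubcubePath s u w l) : (hypercubeGraph n).HasPathOfLength u w l := by
  obtain ⟨p, hp, hl, -⟩ := h
  exact ⟨p, hp, hl⟩

/-- Paths in two opposite facets of a subcube are joined by an edge between the facets. -/
theorem HasSubcubePath.join {s : Finset (Fin n)} {i : Fin n} (hi : i ∈ s)
    {u y w : Fin n → Bool} {a b : ℕ} (h₁ : HasSubcubePath (s.erase i) u y a)
    (h₂ : HasSubcubePath (s.erase i) (flipBit i y) w b) : HasSubcubePath s u w (a + 1 + b) := by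
  obtain ⟨p, hp, rfl, hps⟩ := h₁
  obtain ⟨q, hq, rfl, hqs⟩ := h₂
  have hyi : y i = u i := hps y p.end_mem_support i (by simp)
  refine ⟨p.append (.cons (hypercubeGraph_adj_flipBit i y) q), ?_, ?_, ?_⟩
  · rw [Walk.isPath_def, Walk.support_append, Walk.support_cons, List.tail_cons,
      List.nodup_append']
    refine ⟨hp.support_nodup, hq.support_nodup, fun x hx hx' => ?_⟩
    -- The two halves are disjoint because they disagree in bit `i`.
    have e₁ := hps x hx i (by simp)
    have e₂ := hqs x hx' i (by simp)
    rw [flipBit_apply, if_pos rfl, hyi, e₁] at e₂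
    simp at e₂
  · simp; omega
  · intro x hx j hj
    have hji : j ≠ i := by rintro rfl; exact hj hi
    have hj' : j ∉ s.erase i := fun h => hj (Finset.mem_of_mem_erase h)
    rw [Walk.support_append, Walk.support_cons, List.tail_cons, List.mem_append] at hx
    rcases hx with hx | hx
    · exact hps x hx j hj'
    · rw [hqs x hx j hj', flipBit_apply, if_neg hji, hps y p.end_mem_support j hj']

/-- Induction on dimension: flip `j` in one facet, cross along `i`, flip `j` back in the opposite
facet. -/
theorem hasSubcubePath_flipBit (s : Finset (Fin n)) : ∀ i ∈ s, ∀ (u : Fin n → Bool) (l : ℕ),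
    Odd l → l < 2 ^ s.card → HasSubcubePath s u (flipBit i u) l := by
  induction hm : s.card generalizing s with
  | zero => intro i hi; simp [Finset.card_eq_zero.1 hm] at hi
  | succ m ih =>
    intro i hi u l hodd hl
    have hc : (s.erase i).card = m := by rw [Finset.card_erase_of_mem hi, hm]; rfl
    obtain ⟨r, rfl⟩ := hodd
    rcases Nat.eq_zero_or_pos r with rfl | hr
    · exact .join hi (.refl _ u) (.refl _ _)
    have hm0 : m ≠ 0 := by rintro rfl; simp at hl; omega
    obtain ⟨j, hj⟩ : (s.erase i).Nonempty := by rw [← Finset.card_ne_zero, hc]; exact hm0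
    obtain ⟨t, ht⟩ : Even (2 ^ m) := (Nat.even_pow.2 ⟨even_two, hm0⟩)
    rw [pow_succ, ht] at hl
    rw [ht] at ih
    -- The facets get lengths `2a + 1` and `2b + 1`, each below `2 ^ m = 2t`.
    obtain ⟨a, b, ha, hb, hab⟩ : ∃ a b, a < t ∧ b < t ∧ a + b + 1 = r := by
      rcases le_total r t with h | h
      · exact ⟨r - 1, 0, by omega, by omega, by omega⟩
      · exact ⟨t - 1, r - t, by omega, by omega, by omega⟩
    have h₁ := ih _ hc j hj u (2 * a + 1) (by simp) (by omega)
    have h₂ := ih _ hc j hj (flipBit i (flipBit j u)) (2 * b + 1) (by simp) (by omega)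
    rw [flipBit_comm i j, flipBit_flipBit, flipBit_comm j i] at h₂
    have := HasSubcubePath.join hi h₁ h₂
    rwa [show 2 * a + 1 + 1 + (2 * b + 1) = 2 * r + 1 by omega] at this

/-- Short paths flip `j` within a facet and end by crossing along `i`. Longer ones flip a third bit
`k` at the maximal odd length, cross, then flip `j` and `k` by induction. -/
theorem hasSubcubePath_flipBit_flipBit (s : Finset (Fin n)) :
    ∀ i ∈ s, ∀ j ∈ s, i ≠ j → ∀ (u : Fin n → Bool) (l : ℕ), Even l → l ≠ 0 → l < 2 ^ s.card →
      HasSubcubePath s u (flipBit i (flipBit j u)) l := by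
  induction hm : s.card generalizing s with
  | zero => intro i hi; simp [Finset.card_eq_zero.1 hm] at hi
  | succ m ih =>
    intro i hi j hj hij u l heven hl0 hl
    have hc : (s.erase i).card = m := by rw [Finset.card_erase_of_mem hi, hm]; rfl
    have hj' : j ∈ s.erase i := Finset.mem_erase.2 ⟨hij.symm, hj⟩
    have hm0 : m ≠ 0 := by rintro rfl; simp [Finset.card_eq_zero.1 hc] at hj'
    obtain ⟨t, ht⟩ : Even (2 ^ m) := (Nat.even_pow.2 ⟨even_two, hm0⟩)
    obtain ⟨r, rfl⟩ := heven
    rw [pow_succ, ht] at hl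
    rw [ht] at ih
    rcases le_or_gt r t with h | h
    · have h₁ := hasSubcubePath_flipBit (s.erase i) j hj' u (2 * (r - 1) + 1) (by simp)
        (by rw [hc, ht]; omega)
      have := HasSubcubePath.join hi h₁ (.refl _ _)
      rwa [show 2 * (r - 1) + 1 + 1 + 0 = r + r by omega] at this
    · obtain ⟨k, hk, hkj⟩ : ∃ k ∈ s.erase i, k ≠ j := by
        refine Finset.exists_mem_ne ?_ j
        rw [hc]
        -- A third direction exists: `m = 1` would give `t = 1` and `r < 2`, against `t < r`.
        by_contra hm1
        obtain rfl : m = 1 := by omega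
        omega
      have h₁ := hasSubcubePath_flipBit (s.erase i) k hk u (2 * (t - 1) + 1) (by simp)
        (by rw [hc, ht]; omega)
      have h₂ := ih _ hc j hj' k hk hkj.symm (flipBit i (flipBit k u)) (r - t + (r - t)) (by simp)
        (by omega) (by omega)
      rw [flipBit_comm k i, flipBit_flipBit, flipBit_comm j i] at h₂
      have := HasSubcubePath.join hi h₁ h₂
      rwa [show 2 * (t - 1) + 1 + 1 + (r - t + (r - t)) = r + r by omega] at this

theorem hypercubeGraph_length_lt {u w : Fin n → Bool} {l : ℕ}
    (h : (hypercubeGraph n).HasPathOfLength u w l) :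
    l < 2 ^ (Finset.univ : Finset (Fin n)).card := by
  obtain ⟨p, hp, rfl⟩ := h
  simpa using hp.length_lt

theorem hypercubeGraph_explorerForces_le_four {i j : Fin n} (hij : i ≠ j) {v : Fin n → Bool}
    {k : ℕ} (h : (hypercubeGraph n).ExplorerForces k v {v}) : k ≤ 4 := by
  let F : Finset (Fin n → Bool) := {v, flipBit j v, flipBit i v, flipBit i (flipBit j v)}
  have hFi : ∀ u ∈ F, flipBit i u ∈ F := by
    intro u hu
    simp only [F, Finset.mem_insert, Finset.mem_singleton] at hu ⊢
    rcases hu with rfl | rfl | rfl | rfl <;> simp [flipBit_flipBit]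
  have hFj : ∀ u ∈ F, flipBit j u ∈ F := by
    intro u hu
    simp only [F, Finset.mem_insert, Finset.mem_singleton] at hu ⊢
    rcases hu with rfl | rfl | rfl | rfl <;> simp [flipBit_flipBit, flipBit_comm j i]
  refine (h.le_card_of_trap (F := F) ?_ (by simp [F]) (by simp [F])).trans Finset.card_le_four
  rintro u hu l hl ⟨w, hw⟩
  have hlt := hypercubeGraph_length_lt hw
  rcases Nat.even_or_odd l with he | ho
  · exact ⟨_, hFi _ (hFj _ hu), (hasSubcubePath_flipBit_flipBit _ i (Finset.mem_univ i) j
      (Finset.mem_univ j) hij u l he (by omega) hlt).hasPathOfLength⟩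
  · exact ⟨_, hFi _ hu,
      (hasSubcubePath_flipBit _ i (Finset.mem_univ i) u l ho hlt).hasPathOfLength⟩

theorem hypercubeGraph_explorerForces_four {i j : Fin n} (hij : i ≠ j) (v : Fin n → Bool) :
    (hypercubeGraph n).ExplorerForces 4 v {v} := by
  refine explorerForces_four (hypercubeParity n)
    (fun u => ⟨_, (hypercubeGraph_adj_flipBit i u).hasPathOfLength_one⟩)
    (fun u => ⟨_, HasSubcubePath.hasPathOfLength (s := {i, j})
      (hasSubcubePath_flipBit_flipBit _ i (by simp) j (by simp) hij u 2 even_two two_ne_zero ?_)⟩) v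
  rw [Finset.card_pair hij]
  norm_num

end flipBit

theorem mainTheorem5 (n : ℕ) (v : Fin n → Bool) :
    (hypercubeGraph n).pathExplorerDirectorNumber v =
      if n = 0 then 1 else if n = 1 then 2 else 4 := by
  refine (isGreatest_pathExplorerDirectorNumber _ v).unique ?_
  split_ifs with h0 h1
  · subst h0
    exact ⟨.done _ _ (by simp), fun k hk => by simpa using hk.le_card⟩
  · subst h1
    refine ⟨.call _ _ 1 le_rfl ⟨_, (hypercubeGraph_adj_flipBit 0 v).hasPathOfLength_one⟩
      fun w hw => .done _ _ ?_, fun k hk => by simpa using hk.le_card⟩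
    rw [Finset.card_pair (hw.ne one_ne_zero).symm]
  · have hij : (⟨0, by omega⟩ : Fin n) ≠ ⟨1, by omega⟩ := by simp
    exact ⟨hypercubeGraph_explorerForces_four hij v,
      fun k hk => hypercubeGraph_explorerForces_le_four hij hk⟩
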